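/- Let $\Lambda$ be a finite $2$-graph with vertex set $\{u,v,w,x\}$ and vertex matrices (rows and columns in the order $u,v,w,x$; $A_i(a,b)=|a\Lambda^{e_i}b|$ is the number of edges of degree $e_i$ with range $a$ and source $b$) \[ A_1=\begin{pmatrix}2&6&1&0\\0&0&0&1\\0&0&0&12\\0&0&0&8\end{pmatrix},\qquad A_2=\begin{pmatrix}6&18&0&0\\0&0&1&0\\0&0&0&18\\0&0&0&12\end{pmatrix}. \] Let $\mathcal{T}C^*(\Lambda)$ be the Toeplitz algebra of $\Lambda$, that is, the $C^*$-algebra generated by a universal Toeplitz--Cuntz--Krieger $\Lambda$-family $\{t_\mu:\mu\in\Lambda\}$: the $t_a$ ($a\in\Lambda^0$) are mutually orthogonal projections, $t_\mu t_\nu=t_{\mu\nu}$ when $s(\mu)=r(\nu)$, $t_\mu^*t_\mu=t_{s(\mu)}$, and $t_\mu^*t_\nu=\sum t_\alpha t_\beta^*$ when $r(\mu)=r(\nu)$, where the sum is over all $(\alpha,\beta)$ with $\mu\alpha=\nu\beta$ and $d(\mu\alpha)=d(\mu)\vee d(\nu)$. Let $r=(r_1,r_2)$ with $r_1=\ln 8$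 and $r_2>\ln 12$, and let $\alpha^r:\mathbb{R}\to\operatorname{Aut}\mathcal{T}C^*(\Lambda)$ be the dynamics with $\alpha^r_s(t_\mu)=e^{is\,r\cdot d(\mu)}t_\mu$. The set $\{x\}$ is hereditary; let $q_{\{x\}}:\mathcal{T}C^*(\Lambda)\to\mathcal{T}C^*(\Lambda\backslash\{x\})$ be the quotient map, which sends $t_\mu$ to $t_\mu$ if $s(\mu)\neq x$ and to $0$ if $s(\mu)=x$. Let $\beta<1$ be a real number and let $\phi$ be a KMS$_\beta$ state of $(\mathcal{T}C^*(\Lambda),\alpha^r)$, that is, a state with $\phi(ab)=\phi(b\,\alpha^r_{i\beta}(a))$ for all $\alpha^r$-analytic elements $a,b$. Then $\phi(t_x)=0$, and $\phi$ factors through $q_{\{x\}}$: there is a state $\psi$ of $\mathcal{T}C^*(\Lambda\backslash\{x\})$ such that $\phi=\psi\circ q_{\{x\}}$. -/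

import Mathlib

open CategoryTheory

/-! ### Finite higher-rank graphs -/

/-- A finite `k`-graph: a small category with a degree functor into `ℕ^k` satisfying the unique
factorisation property, and with finitely many paths of each degree.

A path with source `a` and range `b` is a morphism `a ⟶ b`, and the composite written `μν` in the
`k`-graph literature is `ν ≫ μ`. Vertices are identified with the identity morphisms. -/
structure FinKGraph (k : ℕ) where
  /-- The vertices. -/
  Obj : Type
  [cat : SmallCategory Obj]
  /-- The degree map. -/
  deg : ∀ {a b : Obj}, (a ⟶ b) → (Fin k → ℕ)
  deg_id : ∀ a : Obj, deg (𝟙 a) = 0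
  deg_comp : ∀ {a b c : Obj} (ν : a ⟶ b) (μ : b ⟶ c), deg (ν ≫ μ) = deg μ + deg ν
  /-- Every path of degree `m + n` is uniquely `μν` with `d(μ) = m` and `d(ν) = n`. -/
  factor : ∀ {a c : Obj} (l : a ⟶ c) (m n : Fin k → ℕ), deg l = m + n →
    ∃! p : Σ b : Obj, (a ⟶ b) × (b ⟶ c),
      deg p.2.2 = m ∧ deg p.2.1 = n ∧ p.2.1 ≫ p.2.2 = l
  finite_paths : ∀ n : Fin k → ℕ, Finite {p : Σ a b : Obj, (a ⟶ b) // deg p.2.2 = n}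

attribute [instance] FinKGraph.cat

namespace FinKGraph

variable {k : ℕ} (Λ : FinKGraph k)

/-- The minimal common extensions `Λ^min(μ, ν)` of two paths with the same range: the pairs
`(α, β)` with `μα = νβ` and `d(μα) = d(μ) ∨ d(ν)`. The first component of the triple is the
common source of `α` and `β`. -/
def minExt {a b c : Λ.Obj} (μ : a ⟶ c) (ν : b ⟶ c) : Set (Σ e : Λ.Obj, (e ⟶ a) × (e ⟶ b)) :=
  {p | p.2.1 ≫ μ = p.2.2 ≫ ν ∧ Λ.deg (p.2.1 ≫ μ) = Λ.deg μ ⊔ Λ.deg ν}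

/-- A set `H` of vertices is hereditary if `v ∈ H` and `vΛw ≠ ∅` imply `w ∈ H`. -/
def IsHereditary (H : Set Λ.Obj) : Prop :=
  ∀ ⦃v w : Λ.Obj⦄, v ∈ H → Nonempty (w ⟶ v) → w ∈ H

/-- The category of paths of `Λ` between vertices outside `H`. -/
@[reducible] def removeCat (H : Set Λ.Obj) : SmallCategory {v : Λ.Obj // v ∉ H} where
  Hom a b := (a.1 ⟶ b.1)
  id a := 𝟙 a.1
  comp f g := CategoryStruct.comp (obj := Λ.Obj) f g
  id_comp f := Category.id_comp (obj := Λ.Obj) f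
  comp_id f := Category.comp_id (obj := Λ.Obj) f
  assoc f g h := Category.assoc (obj := Λ.Obj) f g h

/-- For hereditary `H`, the `k`-graph `Λ \ H` of paths of `Λ` whose source is not in `H`
(their ranges are then not in `H` either). -/
def remove (H : Set Λ.Obj) (hH : Λ.IsHereditary H) : FinKGraph k where
  Obj := {v : Λ.Obj // v ∉ H}
  cat := Λ.removeCat H
  deg {a b} f := Λ.deg (a := a.1) (b := b.1) f
  deg_id a := Λ.deg_id a.1
  deg_comp {a b c} ν μ := Λ.deg_comp (a := a.1) (b := b.1) (c := c.1) ν μ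
  factor {a c} l m n h := by
    obtain ⟨⟨b, ν, μ⟩, ⟨h1, h2, h3⟩, huniq⟩ := Λ.factor (a := a.1) (c := c.1) l m n h
    have hb : b ∉ H := fun hb => a.2 (hH hb ⟨ν⟩)
    refine ⟨⟨⟨b, hb⟩, ν, μ⟩, ⟨h1, h2, h3⟩, ?_⟩
    rintro ⟨⟨b', hb'⟩, ν', μ'⟩ ⟨h1', h2', h3'⟩
    have := huniq ⟨b', ν', μ'⟩ ⟨h1', h2', h3'⟩
    cases this
    rfl
  finite_paths n := by
    have := Λ.finite_paths n
    refine Finite.of_injective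
      (β := {p : Σ a b : Λ.Obj, (a ⟶ b) // Λ.deg p.2.2 = n})
      (fun p => ⟨⟨p.1.1.1, p.1.2.1.1, p.1.2.2⟩, p.2⟩) ?_
    rintro ⟨⟨⟨a, ha⟩, ⟨b, hb⟩, f⟩, hf⟩ ⟨⟨⟨a', ha'⟩, ⟨b', hb'⟩, f'⟩, hf'⟩ h
    simp only [Subtype.mk.injEq] at h
    cases h
    rfl

/-! ### Toeplitz–Cuntz–Krieger families -/

/-- A Toeplitz–Cuntz–Krieger `Λ`-family in a C*-algebra. -/
@[ext] structure TCKFamily (A : Type*) [NonUnitalCStarAlgebra A] where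
  t : ∀ {a b : Λ.Obj}, (a ⟶ b) → A
  /-- (T1) The `t_v` are mutually orthogonal projections. -/
  star_vertex : ∀ v : Λ.Obj, star (t (𝟙 v)) = t (𝟙 v)
  vertex_mul_self : ∀ v : Λ.Obj, t (𝟙 v) * t (𝟙 v) = t (𝟙 v)
  vertex_mul_vertex : ∀ v w : Λ.Obj, v ≠ w → t (𝟙 v) * t (𝟙 w) = 0
  /-- (T2) `t_μ t_ν = t_{μν}` whenever `s(μ) = r(ν)`. -/
  mul : ∀ {a b c : Λ.Obj} (ν : a ⟶ b) (μ : b ⟶ c), t μ * t ν = t (ν ≫ μ)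
  /-- (T3) `t_μ^* t_μ = t_{s(μ)}`. -/
  star_mul_self : ∀ {a b : Λ.Obj} (μ : a ⟶ b), star (t μ) * t μ = t (𝟙 a)
  /-- (T5) `t_μ^* t_ν = ∑ t_α t_β^*`, over `(α, β) ∈ Λ^min(μ, ν)`, whenever `r(μ) = r(ν)`;
  the sum is finite. -/
  star_mul : ∀ {a b c : Λ.Obj} (μ : a ⟶ c) (ν : b ⟶ c),
    star (t μ) * t ν = ∑ᶠ p ∈ Λ.minExt μ ν, t p.2.1 * star (t p.2.2)

variable {Λ}

lemma TCKFamily.norm_le_one {A : Type*} [NonUnitalCStarAlgebra A] (T : Λ.TCKFamily A)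
    {a b : Λ.Obj} (μ : a ⟶ b) : ‖T.t μ‖ ≤ 1 := by
  have h1 : ‖T.t (𝟙 a)‖ * ‖T.t (𝟙 a)‖ = ‖T.t (𝟙 a)‖ := by
    rw [← CStarRing.norm_star_mul_self, T.star_vertex, T.vertex_mul_self]
  have h2 : ‖T.t μ‖ * ‖T.t μ‖ = ‖T.t (𝟙 a)‖ := by
    rw [← CStarRing.norm_star_mul_self, T.star_mul_self]
  have h3 := norm_nonneg (T.t (𝟙 a))
  have h4 := norm_nonneg (T.t μ)
  have h5 : ‖T.t (𝟙 a)‖ ≤ 1 := by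
    by_contra hc
    push Not at hc
    nlinarith
  nlinarith

variable (Λ)

/-- The index set for the universal representation: all Toeplitz–Cuntz–Krieger `Λ`-families in
all C*-algebras. (Every C*-algebra generated by such a family is separable, hence isomorphic to
one in `Type`.) -/
structure TCKIndex where
  A : Type
  [str : NonUnitalCStarAlgebra A]
  fam : Λ.TCKFamily A

attribute [instance] TCKIndex.str

/-! ### The Toeplitz algebra -/

/-- The product of all the C*-algebras that carry a Toeplitz–Cuntz–Krieger `Λ`-family (bounded
elements, with the supremum norm). -/
abbrev TCKProd : Type 1 := lp (fun i : Λ.TCKIndex => i.A) ⊤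

variable {Λ} in
/-- The element `(T_μ)_T` of the product. -/
noncomputable def prodGen {a b : Λ.Obj} (μ : a ⟶ b) : Λ.TCKProd :=
  ⟨fun i => i.fam.t μ, memℓp_infty ⟨1, by rintro _ ⟨i, rfl⟩; exact i.fam.norm_le_one μ⟩⟩

/-- The C*-subalgebra of the product generated by the elements `(T_μ)_T`. -/
noncomputable def toeplitzSubalgebra : NonUnitalStarSubalgebra ℂ Λ.TCKProd :=
  (NonUnitalStarAlgebra.adjoin ℂ
    {x | ∃ (a b : Λ.Obj) (μ : a ⟶ b), x = prodGen μ}).topologicalClosure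

/-- The Toeplitz algebra `TC*(Λ)`: the C*-algebra generated by a universal
Toeplitz–Cuntz–Krieger `Λ`-family. -/
abbrev TC : Type 1 := Λ.toeplitzSubalgebra

instance : IsClosed (Λ.toeplitzSubalgebra : Set Λ.TCKProd) :=
  NonUnitalStarSubalgebra.isClosed_topologicalClosure _

noncomputable instance : NonUnitalCStarAlgebra Λ.TC :=
  NonUnitalStarSubalgebra.nonUnitalCStarAlgebra Λ.toeplitzSubalgebra

namespace TC

variable {Λ}

/-- The universal generators `t_μ` of `TC*(Λ)`. -/
noncomputable def t {a b : Λ.Obj} (μ : a ⟶ b) : Λ.TC :=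
  ⟨prodGen μ, NonUnitalStarSubalgebra.le_topologicalClosure _
    (NonUnitalStarAlgebra.subset_adjoin ℂ _ ⟨a, b, μ, rfl⟩)⟩

/-- The vertex projections `t_v` of `TC*(Λ)`. -/
noncomputable def vertex (v : Λ.Obj) : Λ.TC := t (𝟙 v)

lemma hom_ext {B : Type*} [NonUnitalCStarAlgebra B] (f g : Λ.TC →⋆ₙₐ[ℂ] B)
    (h : ∀ {a b : Λ.Obj} (μ : a ⟶ b), f (t μ) = g (t μ)) : f = g := by
  have hf : Continuous f :=
    NonUnitalStarAlgHom.instContinuousLinearMapClassComplex.map_continuous f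
  have hg : Continuous g :=
    NonUnitalStarAlgHom.instContinuousLinearMapClassComplex.map_continuous g
  ext ⟨x, hx⟩
  have key : ∀ (y : Λ.TCKProd) (hy : y ∈ NonUnitalStarAlgebra.adjoin ℂ
      {x | ∃ (a b : Λ.Obj) (μ : a ⟶ b), x = prodGen μ}),
      f ⟨y, NonUnitalStarSubalgebra.le_topologicalClosure _ hy⟩ =
        g ⟨y, NonUnitalStarSubalgebra.le_topologicalClosure _ hy⟩ := by
    intro y hy
    induction hy using NonUnitalStarAlgebra.adjoin_induction with
    | mem y hy => obtain ⟨a, b, μ, rfl⟩ := hy; exact h μ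
    | add y z hy hz h1 h2 =>
      have := congrArg₂ (· + ·) h1 h2
      simp only [← map_add] at this
      exact this
    | zero => exact (map_zero f).trans (map_zero g).symm
    | mul y z hy hz h1 h2 =>
      have := congrArg₂ (· * ·) h1 h2
      simp only [← map_mul] at this
      exact this
    | smul c y hy h1 =>
      have := congrArg (c • ·) h1
      simp only [← map_smul] at this
      exact this
    | star y hy h1 =>
      have := congrArg star h1
      simp only [← map_star] at this
      exact this
  have hcl : IsClosed {z : Λ.TC | f z = g z} := isClosed_eq hf hg
  have hd : (⟨x, hx⟩ : Λ.TC) ∈ closure {z : Λ.TC | f z = g z} := by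
    rw [closure_subtype]
    refine closure_mono ?_ hx
    intro y hy
    exact ⟨⟨y, NonUnitalStarSubalgebra.le_topologicalClosure _ hy⟩, key y hy, rfl⟩
  rw [hcl.closure_eq] at hd
  exact hd

lemma minExt_finite {a b c : Λ.Obj} (μ : a ⟶ c) (ν : b ⟶ c) : (Λ.minExt μ ν).Finite := by
  have h1 := Λ.finite_paths (Λ.deg μ ⊔ Λ.deg ν - Λ.deg μ)
  have h2 := Λ.finite_paths (Λ.deg μ ⊔ Λ.deg ν - Λ.deg ν)
  have key : ∀ p ∈ Λ.minExt μ ν, Λ.deg p.2.1 = Λ.deg μ ⊔ Λ.deg ν - Λ.deg μ ∧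
      Λ.deg p.2.2 = Λ.deg μ ⊔ Λ.deg ν - Λ.deg ν := by
    rintro ⟨e, α, β⟩ ⟨hp1, hp2⟩
    have hp3 := hp2
    rw [hp1, Λ.deg_comp] at hp3
    rw [Λ.deg_comp] at hp2
    exact ⟨by rw [← hp2]; simp, by rw [← hp3]; simp⟩
  let g : Λ.minExt μ ν →
      {p : Σ a b : Λ.Obj, (a ⟶ b) // Λ.deg p.2.2 = Λ.deg μ ⊔ Λ.deg ν - Λ.deg μ} ×
      {p : Σ a b : Λ.Obj, (a ⟶ b) // Λ.deg p.2.2 = Λ.deg μ ⊔ Λ.deg ν - Λ.deg ν} :=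
    fun p => (⟨⟨_, _, p.1.2.1⟩, (key _ p.2).1⟩, ⟨⟨_, _, p.1.2.2⟩, (key _ p.2).2⟩)
  have hg : Function.Injective g := by
    rintro ⟨⟨e, α, β⟩, hp⟩ ⟨⟨e', α', β'⟩, hp'⟩ h
    simp only [g, Prod.mk.injEq, Subtype.mk.injEq] at h
    obtain ⟨h3, h4⟩ := h
    cases h3
    cases h4
    rfl
  have := Finite.of_injective g hg
  exact Set.toFinite _

lemma coe_finsum_apply {ι : Type*} {s : Set ι} (hs : s.Finite) (f : ι → Λ.TC) (i : Λ.TCKIndex) :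
    (∑ᶠ p ∈ s, f p : Λ.TC).1 i = ∑ᶠ p ∈ s, (f p).1 i := by
  let g : Λ.TC →+ i.A :=
    { toFun := fun x => x.1 i, map_zero' := rfl, map_add' := fun _ _ => rfl }
  exact g.map_finsum_mem f hs

/-- The generators of `TC*(Λ)` form a Toeplitz–Cuntz–Krieger `Λ`-family. -/
noncomputable def family : Λ.TCKFamily Λ.TC where
  t μ := t μ
  star_vertex v := by
    apply Subtype.ext; ext i; exact i.fam.star_vertex v
  vertex_mul_self v := by
    apply Subtype.ext; ext i; exact i.fam.vertex_mul_self v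
  vertex_mul_vertex v w h := by
    apply Subtype.ext; ext i; exact i.fam.vertex_mul_vertex v w h
  mul ν μ := by
    apply Subtype.ext; ext i; exact i.fam.mul ν μ
  star_mul_self μ := by
    apply Subtype.ext; ext i; exact i.fam.star_mul_self μ
  star_mul μ ν := by
    apply Subtype.ext; ext i
    rw [coe_finsum_apply (minExt_finite μ ν)]
    exact i.fam.star_mul μ ν

/-- The universal property: a Toeplitz–Cuntz–Krieger `Λ`-family `T` induces a homomorphism
`TC*(Λ) → A`, namely evaluation at the coordinate `T`. -/
noncomputable def lift {A : Type} [NonUnitalCStarAlgebra A] (T : Λ.TCKFamily A) :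
    Λ.TC →⋆ₙₐ[ℂ] A where
  toFun f := f.1 ⟨A, T⟩
  map_smul' _ _ := rfl
  map_zero' := rfl
  map_add' _ _ := rfl
  map_mul' _ _ := rfl
  map_star' _ := rfl

lemma lift_t {A : Type} [NonUnitalCStarAlgebra A] (T : Λ.TCKFamily A) {a b : Λ.Obj}
    (μ : a ⟶ b) : lift T (t μ) = T.t μ := rfl

variable {k' : ℕ} {Γ : FinKGraph k'}

/-- A rule `F` turning every `Γ`-family into a `Λ`-family in the same algebra gives a homomorphism
between the products, by evaluation at the transformed families. -/
noncomputable def prodMap (F : ∀ i : Γ.TCKIndex, Λ.TCKFamily i.A) :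
    Λ.TCKProd →⋆ₙₐ[ℂ] Γ.TCKProd where
  toFun f := ⟨fun i => f ⟨i.A, F i⟩, memℓp_infty ⟨‖f‖, by
    rintro _ ⟨i, rfl⟩; exact lp.norm_apply_le_norm ENNReal.top_ne_zero f _⟩⟩
  map_smul' _ _ := rfl
  map_zero' := rfl
  map_add' _ _ := rfl
  map_mul' _ _ := rfl
  map_star' _ := rfl

lemma prodMap_mem (F : ∀ i : Γ.TCKIndex, Λ.TCKFamily i.A)
    (hF : ∀ {a b : Λ.Obj} (μ : a ⟶ b), prodMap F (prodGen μ) ∈ Γ.toeplitzSubalgebra)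
    (x : Λ.TCKProd) (hx : x ∈ Λ.toeplitzSubalgebra) : prodMap F x ∈ Γ.toeplitzSubalgebra := by
  have hc : Continuous (prodMap F) :=
    NonUnitalStarAlgHom.instContinuousLinearMapClassComplex.map_continuous (prodMap F)
  have h1 : Λ.toeplitzSubalgebra ≤ Γ.toeplitzSubalgebra.comap (prodMap F) := by
    refine NonUnitalStarSubalgebra.topologicalClosure_minimal _ ?_ ?_
    · refine NonUnitalStarAlgebra.adjoin_le ?_
      rintro _ ⟨a, b, μ, rfl⟩
      exact hF μ
    · exact (NonUnitalStarSubalgebra.isClosed_topologicalClosure _).preimage hc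
  exact h1 hx

/-- The homomorphism `TC*(Λ) → TC*(Γ)` given by `prodMap`. -/
noncomputable def map (F : ∀ i : Γ.TCKIndex, Λ.TCKFamily i.A)
    (hF : ∀ {a b : Λ.Obj} (μ : a ⟶ b), prodMap F (prodGen μ) ∈ Γ.toeplitzSubalgebra) :
    Λ.TC →⋆ₙₐ[ℂ] Γ.TC :=
  NonUnitalStarAlgHom.codRestrict
    ((prodMap F).comp (NonUnitalStarSubalgebraClass.subtype Λ.toeplitzSubalgebra))
    Γ.toeplitzSubalgebra (fun x => prodMap_mem F hF x.1 x.2)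

end TC

/-! ### The dynamics -/

section Dynamics

variable {Λ}

/-- `e^{i s (r · d(μ))}` -/
noncomputable def phase (r : Fin k → ℝ) (s : ℝ) {a b : Λ.Obj} (μ : a ⟶ b) : ℂ :=
  Complex.exp (Complex.I * ((s * ∑ j, r j * (Λ.deg μ j : ℝ) : ℝ) : ℂ))

lemma phase_id (r : Fin k → ℝ) (s : ℝ) (a : Λ.Obj) : phase r s (𝟙 a) = 1 := by
  simp [phase, Λ.deg_id]

lemma phase_comp (r : Fin k → ℝ) (s : ℝ) {a b c : Λ.Obj} (ν : a ⟶ b) (μ : b ⟶ c) :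
    phase r s (ν ≫ μ) = phase r s μ * phase r s ν := by
  simp only [phase, ← Complex.exp_add, Λ.deg_comp, Pi.add_apply]
  congr 1
  push_cast
  simp only [mul_add, Finset.sum_add_distrib]

lemma star_phase_mul (r : Fin k → ℝ) (s : ℝ) {a b : Λ.Obj} (μ : a ⟶ b) :
    star (phase r s μ) * phase r s μ = 1 := by
  rw [phase, Complex.star_def, ← Complex.exp_conj, ← Complex.exp_add, map_mul, Complex.conj_I,
    Complex.conj_ofReal, ← add_mul]
  simp

/-- The family `e^{i s (r · d(μ))} T_μ`. -/
noncomputable def TCKFamily.twist {A : Type*} [NonUnitalCStarAlgebra A] (T : Λ.TCKFamily A)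
    (r : Fin k → ℝ) (s : ℝ) : Λ.TCKFamily A where
  t μ := phase r s μ • T.t μ
  star_vertex v := by simp [phase_id, T.star_vertex]
  vertex_mul_self v := by simp [phase_id, T.vertex_mul_self]
  vertex_mul_vertex v w h := by simp [phase_id, T.vertex_mul_vertex v w h]
  mul ν μ := by rw [smul_mul_smul_comm, T.mul, phase_comp]
  star_mul_self μ := by
    rw [star_smul, smul_mul_smul_comm, star_phase_mul, T.star_mul_self, phase_id]
  star_mul {a b c} μ ν := by
    rw [star_smul, smul_mul_smul_comm, T.star_mul, smul_finsum]
    refine finsum_congr fun p => ?_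
    rw [smul_finsum]
    refine finsum_congr fun hp => ?_
    rw [star_smul, smul_mul_smul_comm]
    congr 1
    have h1 : phase r s μ * phase r s p.2.1 = phase r s ν * phase r s p.2.2 := by
      rw [← phase_comp, ← phase_comp, hp.1]
    have h2 := star_phase_mul r s μ
    have h3 := star_phase_mul r s p.2.2
    calc star (phase r s μ) * phase r s ν
        = star (phase r s μ) * (phase r s ν * phase r s p.2.2) * star (phase r s p.2.2) := by
          linear_combination (-(star (phase r s μ) * phase r s ν)) * h3
      _ = phase r s p.2.1 * star (phase r s p.2.2) := by
          rw [← h1]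
          linear_combination (phase r s p.2.1 * star (phase r s p.2.2)) * h2

/-- The endomorphism `t_μ ↦ e^{i s (r · d(μ))} t_μ` of `TC*(Λ)`. -/
noncomputable def dynamicsHom (r : Fin k → ℝ) (s : ℝ) : Λ.TC →⋆ₙₐ[ℂ] Λ.TC :=
  TC.map (fun i => i.fam.twist r s) fun μ =>
    SMulMemClass.smul_mem (phase r s μ) (TC.t μ).2

lemma dynamicsHom_t (r : Fin k → ℝ) (s : ℝ) {a b : Λ.Obj} (μ : a ⟶ b) :
    dynamicsHom r s (TC.t μ) = phase r s μ • TC.t μ := rfl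

lemma dynamicsHom_add (r : Fin k → ℝ) (s s' : ℝ) (x : Λ.TC) :
    dynamicsHom r (s + s') x = dynamicsHom r s (dynamicsHom r s' x) := by
  have : dynamicsHom (Λ := Λ) r (s + s') = (dynamicsHom r s).comp (dynamicsHom r s') := by
    refine TC.hom_ext _ _ fun μ => ?_
    rw [NonUnitalStarAlgHom.comp_apply, dynamicsHom_t, dynamicsHom_t, map_smul, dynamicsHom_t,
      smul_smul]
    congr 1
    simp only [phase, ← Complex.exp_add]
    congr 1
    push_cast
    ring
  rw [this]; rfl

lemma dynamicsHom_zero (r : Fin k → ℝ) (x : Λ.TC) : dynamicsHom r 0 x = x := by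
  have : dynamicsHom (Λ := Λ) r 0 = NonUnitalStarAlgHom.id ℂ Λ.TC := by
    refine TC.hom_ext _ _ fun μ => ?_
    rw [dynamicsHom_t]
    simp [phase]
  rw [this]; rfl

variable (Λ) in
/-- The dynamics `α^r : ℝ → Aut TC*(Λ)`, determined by
`α^r_s(t_μ) = e^{i s (r · d(μ))} t_μ`. -/
noncomputable def dynamics (r : Fin k → ℝ) (s : ℝ) : Λ.TC ≃⋆ₐ[ℂ] Λ.TC :=
  { dynamicsHom r s with
    invFun := dynamicsHom r (-s)
    left_inv := fun x => by
      change dynamicsHom r (-s) (dynamicsHom r s x) = x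
      rw [← dynamicsHom_add, neg_add_cancel, dynamicsHom_zero]
    right_inv := fun x => by
      change dynamicsHom r s (dynamicsHom r (-s) x) = x
      rw [← dynamicsHom_add, add_neg_cancel, dynamicsHom_zero] }

end Dynamics

/-! ### The quotient map `q_H` -/

section Quotient

variable {Λ} {H : Set Λ.Obj} (hH : Λ.IsHereditary H)

open Classical in
/-- Extend a family for `Λ \ H` by zero on the paths of `Λ` whose source is in `H`. -/
noncomputable def extendFun {A : Type*} [NonUnitalCStarAlgebra A]
    (T : (Λ.remove H hH).TCKFamily A) {a b : Λ.Obj} (μ : a ⟶ b) : A :=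
  if h : a ∉ H then T.t (a := ⟨a, h⟩) (b := ⟨b, fun hb => h (hH hb ⟨μ⟩)⟩) μ else 0

lemma extendFun_of_notMem {A : Type*} [NonUnitalCStarAlgebra A]
    (T : (Λ.remove H hH).TCKFamily A) {a b : Λ.Obj} (μ : a ⟶ b) (ha : a ∉ H) (hb : b ∉ H) :
    extendFun hH T μ = T.t (a := ⟨a, ha⟩) (b := ⟨b, hb⟩) μ := dif_pos ha

lemma extendFun_of_mem {A : Type*} [NonUnitalCStarAlgebra A]
    (T : (Λ.remove H hH).TCKFamily A) {a b : Λ.Obj} (μ : a ⟶ b) (ha : a ∈ H) :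
    extendFun hH T μ = 0 := dif_neg (not_not.2 ha)

/-- The extension by zero of a family for `Λ \ H` to a family for `Λ`. -/
noncomputable def TCKFamily.extend {A : Type*} [NonUnitalCStarAlgebra A]
    (T : (Λ.remove H hH).TCKFamily A) : Λ.TCKFamily A where
  t μ := extendFun hH T μ
  star_vertex v := by
    by_cases h : v ∈ H
    · simp [extendFun_of_mem hH T _ h]
    · rw [extendFun_of_notMem hH T _ h h]
      exact T.star_vertex ⟨v, h⟩
  vertex_mul_self v := by
    by_cases h : v ∈ H
    · simp [extendFun_of_mem hH T _ h]
    · rw [extendFun_of_notMem hH T _ h h]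
      exact T.vertex_mul_self ⟨v, h⟩
  vertex_mul_vertex v w hvw := by
    by_cases h : v ∈ H
    · simp [extendFun_of_mem hH T _ h]
    by_cases h' : w ∈ H
    · simp [extendFun_of_mem hH T _ h']
    rw [extendFun_of_notMem hH T _ h h, extendFun_of_notMem hH T _ h' h']
    exact T.vertex_mul_vertex ⟨v, h⟩ ⟨w, h'⟩ fun e => hvw (congrArg Subtype.val e)
  mul {a b c} ν μ := by
    by_cases ha : a ∈ H
    · simp [extendFun_of_mem hH T _ ha]
    have hb : b ∉ H := fun hb => ha (hH hb ⟨ν⟩)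
    have hc : c ∉ H := fun hc => hb (hH hc ⟨μ⟩)
    rw [extendFun_of_notMem hH T _ hb hc, extendFun_of_notMem hH T _ ha hb,
      extendFun_of_notMem hH T _ ha hc]
    exact T.mul (a := ⟨a, ha⟩) (b := ⟨b, hb⟩) (c := ⟨c, hc⟩) ν μ
  star_mul_self {a b} μ := by
    by_cases ha : a ∈ H
    · simp [extendFun_of_mem hH T _ ha]
    have hb : b ∉ H := fun hb => ha (hH hb ⟨μ⟩)
    rw [extendFun_of_notMem hH T _ ha hb, extendFun_of_notMem hH T _ ha ha]
    exact T.star_mul_self (a := ⟨a, ha⟩) (b := ⟨b, hb⟩) μ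
  star_mul {a b c} μ ν := by
    have hz : ∀ (p : Σ e : Λ.Obj, (e ⟶ a) × (e ⟶ b)), p.1 ∈ H →
        extendFun hH T p.2.1 * star (extendFun hH T p.2.2) = 0 := fun p hp => by
      rw [extendFun_of_mem hH T p.2.1 hp, zero_mul]
    by_cases ha : a ∈ H
    · rw [extendFun_of_mem hH T _ ha, star_zero, zero_mul, finsum_mem_congr rfl
        fun p _ => hz p (hH ha ⟨p.2.1⟩), finsum_mem_zero]
    by_cases hb : b ∈ H
    · rw [extendFun_of_mem hH T ν hb, mul_zero, finsum_mem_congr rfl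
        fun p _ => hz p (hH hb ⟨p.2.2⟩), finsum_mem_zero]
    have hc : c ∉ H ∨ c ∈ H := (em _).symm
    rcases hc with hc | hc
    swap
    · exact absurd (hH hc ⟨μ⟩) ha
    rw [extendFun_of_notMem hH T _ ha hc, extendFun_of_notMem hH T _ hb hc]
    refine (T.star_mul (a := ⟨a, ha⟩) (b := ⟨b, hb⟩) (c := ⟨c, hc⟩) μ ν).trans ?_
    let g : (Σ e : (Λ.remove H hH).Obj, (e ⟶ (⟨a, ha⟩ : (Λ.remove H hH).Obj)) ×
        (e ⟶ (⟨b, hb⟩ : (Λ.remove H hH).Obj))) → Σ e : Λ.Obj, (e ⟶ a) × (e ⟶ b) :=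
      fun p => ⟨p.1.1, p.2.1, p.2.2⟩
    have hg : Function.Injective g := by
      rintro ⟨⟨e, he⟩, α, β⟩ ⟨⟨e', he'⟩, α', β'⟩ h
      cases h
      rfl
    have hfg : ∀ p, T.t p.2.1 * star (T.t p.2.2) =
        extendFun hH T (g p).2.1 * star (extendFun hH T (g p).2.2) := by
      rintro ⟨⟨e, he⟩, α, β⟩
      rw [extendFun_of_notMem hH T _ he ha, extendFun_of_notMem hH T _ he hb]
    rw [finsum_mem_congr rfl fun p _ => hfg p]
    rw [← finsum_mem_image (f := fun p : Σ e : Λ.Obj, (e ⟶ a) × (e ⟶ b) =>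
      extendFun hH T p.2.1 * star (extendFun hH T p.2.2)) hg.injOn]
    refine finsum_mem_inter_support_eq' _ _ _ ?_
    rintro ⟨e, α, β⟩ hp
    have he : e ∉ H := fun he => hp (hz ⟨e, α, β⟩ he)
    constructor
    · rintro ⟨q, hq, hqp⟩
      rw [← hqp]
      exact hq
    · intro h
      exact ⟨⟨⟨e, he⟩, α, β⟩, h, rfl⟩

/-- The quotient map `q_H : TC*(Λ) → TC*(Λ \ H)` for a hereditary set `H`: it sends `t_μ` to
`t_μ` if `s(μ) ∉ H` and to `0` otherwise. -/
noncomputable def quotientMap : Λ.TC →⋆ₙₐ[ℂ] (Λ.remove H hH).TC :=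
  TC.map (fun i => i.fam.extend hH) fun {a b} μ => by
    by_cases ha : a ∈ H
    · convert zero_mem (Λ.remove H hH).toeplitzSubalgebra
      ext i
      exact extendFun_of_mem hH i.fam μ ha
    · have hb : b ∉ H := fun hb => ha (hH hb ⟨μ⟩)
      convert (TC.t (Λ := Λ.remove H hH) (a := ⟨a, ha⟩) (b := ⟨b, hb⟩) μ).2
      ext i
      exact extendFun_of_notMem hH i.fam μ ha hb

lemma quotientMap_t_of_notMem {a b : Λ.Obj} (μ : a ⟶ b) (ha : a ∉ H) (hb : b ∉ H) :
    quotientMap hH (TC.t μ) = TC.t (Λ := Λ.remove H hH) (a := ⟨a, ha⟩) (b := ⟨b, hb⟩) μ := by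
  apply Subtype.ext
  ext i
  exact extendFun_of_notMem hH i.fam μ ha hb

lemma quotientMap_t_of_mem {a b : Λ.Obj} (μ : a ⟶ b) (ha : a ∈ H) :
    quotientMap hH (TC.t μ) = 0 := by
  apply Subtype.ext
  ext i
  exact extendFun_of_mem hH i.fam μ ha

end Quotient

end FinKGraph

/-! ### KMS states -/

section KMS

variable {A : Type*} [NonUnitalCStarAlgebra A]

open scoped ComplexOrder in
/-- A state of a C*-algebra: a positive linear functional of norm one. -/
def IsCStarState (φ : A →L[ℂ] ℂ) : Prop :=
  (∀ a : A, 0 ≤ φ (star a * a)) ∧ ‖φ‖ = 1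

/-- `F` is the (unique) entire extension of `s ↦ α_s(a)`, so that `α_z(a) = F z`. An element `a`
is analytic for `α` if such an `F` exists. -/
def IsAnalyticExtension (α : ℝ → A ≃⋆ₐ[ℂ] A) (a : A) (F : ℂ → A) : Prop :=
  Differentiable ℂ F ∧ ∀ s : ℝ, F s = α s a

/-- `φ` is a KMS state of `(A, α)` at inverse temperature `β`: it is a state and
`φ(ab) = φ(b α_{iβ}(a))` for all analytic elements `a` and `b`. -/
def IsKMSState (α : ℝ → A ≃⋆ₐ[ℂ] A) (β : ℝ) (φ : A →L[ℂ] ℂ) : Prop :=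
  IsCStarState φ ∧ ∀ (a b : A) (F G : ℂ → A), IsAnalyticExtension α a F →
    IsAnalyticExtension α b G → φ (a * b) = φ (b * F (Complex.I * β))

end KMS

/-! ### The four-vertex skeleton -/

/-- The vertices `u, v, w, x`. -/
inductive FourVertex
  | u | v | w | x

/-- The vertex matrices of the skeleton: `fourVertexMatrix i a b` is the number `|a Λ^{e_i} b|` of
edges of colour `i` (`0` blue, `1` red) from `b` to `a`. -/
def fourVertexMatrix : Fin 2 → FourVertex → FourVertex → ℕ
  | 0, .u, .u => 2
  | 0, .u, .v => 6
  | 0, .u, .w => 1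
  | 0, .v, .x => 1
  | 0, .w, .x => 12
  | 0, .x, .x => 8
  | 1, .u, .u => 6
  | 1, .u, .v => 18
  | 1, .v, .w => 1
  | 1, .w, .x => 18
  | 1, .x, .x => 12
  | _, _, _ => 0

namespace FinKGraph

/-- The 2-graph `Λ`, with vertices labelled `u, v, w, x` by `e`, has the four-vertex skeleton. -/
def HasFourVertexSkeleton (Λ : FinKGraph 2) (e : FourVertex ≃ Λ.Obj) : Prop :=
  ∀ (i : Fin 2) (a b : FourVertex),
    Nat.card {f : e b ⟶ e a // Λ.deg f = Pi.single i 1} = fourVertexMatrix i a b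

variable {Λ : FinKGraph 2} {e : FourVertex ≃ Λ.Obj}

lemma HasFourVertexSkeleton.isEmpty (h : Λ.HasFourVertexSkeleton e) (i : Fin 2)
    (a b : FourVertex) (hab : fourVertexMatrix i a b = 0) (f : e b ⟶ e a) :
    Λ.deg f ≠ Pi.single i 1 := by
  intro hf
  have hfin : Finite {f : e b ⟶ e a // Λ.deg f = Pi.single i 1} := by
    have := Λ.finite_paths (Pi.single i 1)
    refine Finite.of_injective (β := {p : Σ a b : Λ.Obj, (a ⟶ b) // Λ.deg p.2.2 = Pi.single i 1})
      (fun p => ⟨⟨_, _, p.1⟩, p.2⟩) ?_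
    rintro ⟨f, hf⟩ ⟨g, hg⟩ hfg
    simpa using hfg
  have hne : Nonempty {f : e b ⟶ e a // Λ.deg f = Pi.single i 1} := ⟨⟨f, hf⟩⟩
  have := Nat.card_pos (α := {f : e b ⟶ e a // Λ.deg f = Pi.single i 1})
  rw [h, hab] at this
  exact lt_irrefl _ this

lemma HasFourVertexSkeleton.isHereditary (h : Λ.HasFourVertexSkeleton e) :
    Λ.IsHereditary {e .x} := by
  have key : ∀ (n : ℕ) (w : Λ.Obj) (f : w ⟶ e .x), ∑ i, Λ.deg f i = n → w = e .x := by
    intro n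
    induction n with
    | zero =>
      intro w f hf
      have h0 : Λ.deg f = 0 := by
        funext i
        exact (Finset.sum_eq_zero_iff.1 hf) i (Finset.mem_univ i)
      obtain ⟨q, -, hq⟩ := Λ.factor f 0 0 (by simpa using h0)
      have h1 := hq ⟨w, 𝟙 w, f⟩ ⟨h0, Λ.deg_id w, Category.id_comp f⟩
      have h2 := hq ⟨e .x, f, 𝟙 _⟩ ⟨Λ.deg_id _, h0, Category.comp_id f⟩
      exact congrArg Sigma.fst (h1.trans h2.symm)
    | succ n ih =>
      intro w f hf
      obtain ⟨i, hi⟩ : ∃ i, Λ.deg f i ≠ 0 := by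
        by_contra hc
        push Not at hc
        simp [hc] at hf
      have hle : Pi.single i 1 ≤ Λ.deg f := by
        intro j
        by_cases hj : j = i
        · subst hj
          simpa using Nat.one_le_iff_ne_zero.2 hi
        · simp [Pi.single_eq_of_ne hj]
      have hd : Λ.deg f = Pi.single i 1 + (Λ.deg f - Pi.single i 1) :=
        (add_tsub_cancel_of_le hle).symm
      obtain ⟨⟨b, ν, μ⟩, ⟨h1, h2, -⟩, -⟩ := Λ.factor f _ _ hd
      have hb : b = e .x := by
        obtain ⟨b', rfl⟩ := e.surjective b
        by_contra hne
        refine h.isEmpty i .x b' ?_ μ h1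
        fin_cases i <;> cases b' <;> first | rfl | exact absurd rfl hne
      subst hb
      refine ih w ν ?_
      have h3 : ∑ j, Λ.deg f j = ∑ j, (Pi.single i 1 : Fin 2 → ℕ) j + ∑ j, Λ.deg ν j := by
        rw [← Finset.sum_add_distrib]
        refine Finset.sum_congr rfl fun j _ => ?_
        have : Λ.deg ν = Λ.deg f - Pi.single i 1 := h2
        rw [this]
        exact congrFun hd j
      rw [hf] at h3
      have h4 : ∑ j, (Pi.single i 1 : Fin 2 → ℕ) j = 1 := by
        fin_cases i <;> simp
      omega
  rintro v w hv ⟨f⟩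
  rw [Set.mem_singleton_iff] at hv
  subst hv
  exact key _ w f rfl

end FinKGraph

/-! ### Separability -/

/-! Vanishing at `x` is a counting argument. The eight loops of degree `e₁` at `x` have mutually
orthogonal range projections below `t_x`. By the KMS condition each of them has `φ`-value `e^{-β ln
8} φ(t_x) = 8^{-β} φ(t_x)`. Positivity gives `φ(t_x) ≥ 8^{1-β} φ(t_x)`, and `8^{1-β} > 1` because `β
< 1`, so `φ(t_x) = 0` (`kms_vertex_eq_zero`).

The factorisation needs no description of the kernel of `q_H`. In the GNS representation `π` of `φ`,
Cauchy–Schwarz gives `φ(t_x c) = 0` for all `c`. The KMS condition moves `b^*` to the other side in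
`φ(b^* t_x b)`, which therefore vanishes too, and `π(t_x) = 0` (`gns_vertex_eq_zero`). The family
`π(t_μ)` then lives on `Λ \ H`, so the universal property gives `ρ` with `ρ ∘ q_H = π`, and `ψ` is
the vector functional of `ρ` at the image of the unit (`kms_factors_quotientMap`).

Separability settles a question of universes: `TC*(Λ)` lies in `Type 1`, while `TC.lift` accepts
only targets in `Type`. The GNS space is separable, hence isometric to `ℓ²` of a set of natural
numbers, and the representation is transported there. -/

lemma Subsemigroup.countable_closure {M : Type*} [Semigroup M] {s : Set M} (hs : s.Countable) :
    (Subsemigroup.closure s : Set M).Countable := by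
  have : Countable s := hs
  have : Countable (FreeSemigroup s) :=
    Function.Injective.countable (f := fun w : FreeSemigroup s => (w.head, w.tail))
      fun a b h => by cases a; cases b; simpa using h
  have h : Subsemigroup.closure s ≤ (FreeSemigroup.lift ((↑) : s → M)).srange :=
    Subsemigroup.closure_le.2 fun x hx => ⟨FreeSemigroup.of ⟨x, hx⟩, rfl⟩
  exact (Set.countable_range (FreeSemigroup.lift ((↑) : s → M))).mono fun x hx => h hx

/-- The generated star-algebra is the linear span of the words in `s ∪ s^*`, and there are only
countably many words. -/
lemma isSeparable_adjoin_topologicalClosure {A : Type*} [NonUnitalCStarAlgebra A] {s : Set A}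
    (hs : s.Countable) :
    TopologicalSpace.IsSeparable
      ((NonUnitalStarAlgebra.adjoin ℂ s).topologicalClosure : Set A) := by
  change TopologicalSpace.IsSeparable (closure (NonUnitalStarAlgebra.adjoin ℂ s : Set A))
  refine TopologicalSpace.IsSeparable.closure ?_
  have h : (NonUnitalStarAlgebra.adjoin ℂ s : Set A) =
      Submodule.span ℂ (Subsemigroup.closure (s ∪ star s) : Set A) := by
    rw [← NonUnitalStarAlgebra.adjoin_eq_span]; rfl
  rw [h]
  refine TopologicalSpace.IsSeparable.span
    (Subsemigroup.countable_closure (hs.union ?_)).isSeparable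
  rw [← Set.image_star]
  exact hs.image _

/-- Distinct orthonormal vectors are at distance `√2 ≥ 1`, so the balls of radius `1/2` around them
are disjoint open sets. -/
lemma Orthonormal.countable_of_separableSpace {E : Type*} [NormedAddCommGroup E]
    [InnerProductSpace ℂ E] [TopologicalSpace.SeparableSpace E] {w : Set E}
    (hw : Orthonormal ℂ ((↑) : w → E)) : w.Countable := by
  refine Set.PairwiseDisjoint.countable_of_isOpen (s := fun x : E => Metric.ball x (1 / 2)) ?_
    (fun _ _ => Metric.isOpen_ball) (fun x _ => ⟨x, Metric.mem_ball_self (by norm_num)⟩)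
  intro x hx y hy hxy
  refine Metric.ball_disjoint_ball ?_
  have h0 : inner ℂ x y = 0 := hw.2 (i := ⟨x, hx⟩) (j := ⟨y, hy⟩) (by simpa using hxy)
  have h1 : ‖x‖ = 1 := hw.1 ⟨x, hx⟩
  have h2 : ‖y‖ = 1 := hw.1 ⟨y, hy⟩
  have h3 : ‖x - y‖ ^ 2 = 2 := by
    rw [@norm_sub_sq ℂ, h0, h1, h2]; norm_num
  rw [dist_eq_norm]
  nlinarith [norm_nonneg (x - y)]

/-- A separable Hilbert space, in any universe, is isometric to `ℓ²` of a set of natural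
numbers. -/
lemma exists_linearIsometryEquiv_lp_nat (E : Type*) [NormedAddCommGroup E]
    [InnerProductSpace ℂ E] [CompleteSpace E] [TopologicalSpace.SeparableSpace E] :
    ∃ s : Set ℕ, Nonempty (E ≃ₗᵢ[ℂ] lp (fun _ : s => ℂ) 2) := by
  obtain ⟨w, b, hb⟩ := exists_hilbertBasis ℂ E
  have hw : Countable w := (hb ▸ b.orthonormal).countable_of_separableSpace
  obtain ⟨f, hf⟩ := exists_injective_nat w
  let g : Set.range f ≃ w := (Equiv.ofInjective f hf).symm
  refine ⟨Set.range f, ⟨(HilbertBasis.mk (v := b ∘ g) (b.orthonormal.comp g g.injective) ?_).repr⟩⟩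
  rw [g.surjective.range_comp, b.dense_span]

/-! ### The GNS representation -/

/-- Conjugation by a surjective isometry, as a homomorphism. -/
noncomputable def LinearIsometryEquiv.conjStarHom {E F : Type*} [NormedAddCommGroup E]
    [InnerProductSpace ℂ E] [CompleteSpace E] [NormedAddCommGroup F] [InnerProductSpace ℂ F]
    [CompleteSpace F] (U : E ≃ₗᵢ[ℂ] F) : (E →L[ℂ] E) →⋆ₙₐ[ℂ] (F →L[ℂ] F) where
  toFun := U.conjStarAlgEquiv
  map_smul' c x := ContinuousLinearMap.ext fun y => U.map_smul c (x (U.symm y))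
  map_zero' := ContinuousLinearMap.ext fun _ => U.map_zero
  map_add' x y := ContinuousLinearMap.ext fun z => U.map_add (x (U.symm z)) (y (U.symm z))
  map_mul' := U.conjStarAlgEquiv.map_mul'
  map_star' := U.conjStarAlgEquiv.map_star'

open scoped ComplexOrder InnerProductSpace in
/-- The GNS representation of a positive functional on a separable C*-algebra, on a Hilbert space
in `Type`. -/
theorem exists_gns {A : Type*} [NonUnitalCStarAlgebra A] [TopologicalSpace.SeparableSpace A]
    (φ : A →L[ℂ] ℂ) (hφ : ∀ a : A, 0 ≤ φ (star a * a)) :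
    ∃ (s : Set ℕ) (π : A →⋆ₙₐ[ℂ] (lp (fun _ : s => ℂ) 2 →L[ℂ] lp (fun _ : s => ℂ) 2))
      (V : A → lp (fun _ : s => ℂ) 2), DenseRange V ∧
      (∀ a b, ⟪V a, V b⟫_ℂ = φ (star a * b)) ∧ ∀ a b, π a (V b) = V (a * b) := by
  -- The nonnegative elements of the spectral order are exactly the `b^* b`, so `hφ` makes `φ` a
  -- positive map for this order.
  let _ := CStarAlgebra.spectralOrder A
  have := CStarAlgebra.spectralOrderedRing A
  let f : A →ₚ[ℂ] ℂ := PositiveLinearMap.mk₀ φ.toLinearMap fun a ha => by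
    obtain ⟨b, rfl⟩ := CStarAlgebra.nonneg_iff_eq_star_mul_self.1 ha
    exact hφ b
  let V₀ : A →ₗ[ℂ] f.GNS :=
    (UniformSpace.Completion.toComplₗᵢ (𝕜 := ℂ) (E := f.PreGNS)).toLinearMap ∘ₗ
      f.toPreGNS.toLinearMap
  have hVdef : ∀ a, V₀ a = (f.toPreGNS a : f.GNS) := fun _ => rfl
  have hin : ∀ a b, ⟪V₀ a, V₀ b⟫_ℂ = φ (star a * b) := fun a b => by
    rw [hVdef, hVdef, UniformSpace.Completion.inner_coe, f.preGNS_inner_def]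
    rfl
  -- This bound makes `V₀` continuous; since its range is dense, separability passes from `A` to the
  -- GNS space.
  have hbound : ∀ a, ‖V₀ a‖ ≤ √‖φ‖ * ‖a‖ := fun a => by
    refine le_of_sq_le_sq ?_ (by positivity)
    rw [mul_pow, Real.sq_sqrt (norm_nonneg _)]
    calc ‖V₀ a‖ ^ 2 = ‖⟪V₀ a, V₀ a⟫_ℂ‖ := by
          rw [inner_self_eq_norm_sq_to_K]; simp
      _ = ‖φ (star a * a)‖ := by rw [hin]
      _ ≤ ‖φ‖ * ‖star a * a‖ := φ.le_opNorm _
      _ = ‖φ‖ * ‖a‖ ^ 2 := by rw [CStarRing.norm_star_mul_self, sq]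
  have hcont : Continuous V₀ := (V₀.mkContinuous _ hbound).continuous
  have hdense : DenseRange V₀ := by
    have h : Function.Surjective f.toPreGNS := f.toPreGNS.surjective
    exact UniformSpace.Completion.denseRange_coe.comp h.denseRange
      (UniformSpace.Completion.continuous_coe _)
  have : TopologicalSpace.SeparableSpace f.GNS := hdense.separableSpace hcont
  obtain ⟨s, ⟨U⟩⟩ := exists_linearIsometryEquiv_lp_nat f.GNS
  refine ⟨s, U.conjStarHom.comp f.gnsNonUnitalStarAlgHom, fun a => U (V₀ a), ?_, ?_, ?_⟩
  · exact U.surjective.denseRange.comp hdense U.continuous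
  · intro a b
    rw [U.inner_map_map, hin]
  · intro a b
    change U (f.gnsNonUnitalStarAlgHom a (U.symm (U (V₀ b)))) = _
    rw [U.symm_apply_apply, hVdef, f.gnsNonUnitalStarAlgHom_apply_coe]
    rfl


/-! ### Analytic elements -/

section Analytic

variable {A : Type*} [NonUnitalCStarAlgebra A] {α : ℝ → A ≃⋆ₐ[ℂ] A} {a b : A} {F G : ℂ → A}

lemma IsAnalyticExtension.add (hF : IsAnalyticExtension α a F) (hG : IsAnalyticExtension α b G) :
    IsAnalyticExtension α (a + b) (fun z => F z + G z) :=
  ⟨hF.1.add hG.1, fun s => by beta_reduce; rw [hF.2, hG.2, map_add]⟩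

lemma IsAnalyticExtension.smul (c : ℂ) (hF : IsAnalyticExtension α a F) :
    IsAnalyticExtension α (c • a) (fun z => c • F z) :=
  ⟨hF.1.const_smul c, fun s => by beta_reduce; rw [hF.2, map_smul]⟩

lemma IsAnalyticExtension.mul (hF : IsAnalyticExtension α a F) (hG : IsAnalyticExtension α b G) :
    IsAnalyticExtension α (a * b) (fun z => F z * G z) := by
  refine ⟨fun z => ?_, fun s => by beta_reduce; rw [hF.2, hG.2, map_mul]⟩
  exact ((ContinuousLinearMap.mul ℂ A).isBoundedBilinearMap.differentiableAt (F z, G z)).comp z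
    ((hF.1 z).prodMk (hG.1 z))

lemma isAnalyticExtension_zero : IsAnalyticExtension α 0 (fun _ => 0) :=
  ⟨differentiable_const _, fun s => (map_zero (α s)).symm⟩

/-- On an eigenvector the dynamics is multiplication by `e^{isc}`, which is entire in `s`. -/
lemma isAnalyticExtension_of_eigen (c : ℝ)
    (h : ∀ s : ℝ, α s a = Complex.exp (Complex.I * ((s * c : ℝ) : ℂ)) • a) :
    IsAnalyticExtension α a (fun z => Complex.exp (Complex.I * (z * c)) • a) := by
  refine ⟨?_, fun s => by beta_reduce; rw [h]; push_cast; rfl⟩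
  have : Differentiable ℂ fun z : ℂ => Complex.exp (Complex.I * (z * c)) := by fun_prop
  exact this.smul_const a

variable (α) in
/-- The elements `a` such that `a` and `a^*` are analytic. -/
def analyticSubalgebra : NonUnitalStarSubalgebra ℂ A where
  -- Requiring both `a` and `a^*` to be analytic makes closure under the star a swap, and avoids
  -- proving that `z ↦ F(z̄)^*` is entire.
  carrier := {a | (∃ F, IsAnalyticExtension α a F) ∧ ∃ F, IsAnalyticExtension α (star a) F}
  add_mem' := by
    rintro a b ⟨⟨F, hF⟩, ⟨F', hF'⟩⟩ ⟨⟨G, hG⟩, ⟨G', hG'⟩⟩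
    exact ⟨⟨_, hF.add hG⟩, _, by rw [star_add]; exact hF'.add hG'⟩
  zero_mem' := ⟨⟨_, isAnalyticExtension_zero⟩, _, by
    rw [star_zero]; exact isAnalyticExtension_zero⟩
  mul_mem' := by
    rintro a b ⟨⟨F, hF⟩, ⟨F', hF'⟩⟩ ⟨⟨G, hG⟩, ⟨G', hG'⟩⟩
    exact ⟨⟨_, hF.mul hG⟩, _, by rw [star_mul]; exact hG'.mul hF'⟩
  smul_mem' := by
    rintro c a ⟨⟨F, hF⟩, ⟨F', hF'⟩⟩
    exact ⟨⟨_, hF.smul c⟩, _, by rw [star_smul]; exact hF'.smul (star c)⟩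
  star_mem' := by
    rintro a ⟨⟨F, hF⟩, ⟨F', hF'⟩⟩
    exact ⟨⟨F', hF'⟩, F, by rw [star_star]; exact hF⟩

end Analytic

namespace FinKGraph

variable {k : ℕ} {Λ : FinKGraph k}

/-! ### The generators of the Toeplitz algebra -/

/-- There are countably many degrees, and finitely many paths of each degree. -/
instance : Countable (Σ a b : Λ.Obj, (a ⟶ b)) := by
  have (n : Fin k → ℕ) := Λ.finite_paths n
  exact Function.Injective.countable
    (β := Σ n : Fin k → ℕ, {p : Σ a b : Λ.Obj, (a ⟶ b) // Λ.deg p.2.2 = n})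
    (f := fun p => ⟨Λ.deg p.2.2, p, rfl⟩) (Function.LeftInverse.injective (g := fun q => q.2.1)
      fun _ => rfl)

instance : TopologicalSpace.SeparableSpace Λ.TC := by
  refine TopologicalSpace.IsSeparable.separableSpace
    (isSeparable_adjoin_topologicalClosure (Set.Countable.mono ?_
      (Set.countable_range fun p : Σ a b : Λ.Obj, (a ⟶ b) => prodGen p.2.2)))
  rintro _ ⟨a, b, μ, rfl⟩
  exact ⟨⟨a, b, μ⟩, rfl⟩

/-- The image of `S` in the product contains the generators, hence all of the star-algebra whose
closure is `TC*(Λ)`. -/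
lemma TC.dense_of_t_mem (S : NonUnitalStarSubalgebra ℂ Λ.TC)
    (h : ∀ {a b : Λ.Obj} (μ : a ⟶ b), TC.t μ ∈ S) : Dense (S : Set Λ.TC) := by
  rintro ⟨x, hx⟩
  rw [closure_subtype]
  have hle : NonUnitalStarAlgebra.adjoin ℂ
      {x | ∃ (a b : Λ.Obj) (μ : a ⟶ b), x = prodGen μ} ≤
      S.map (NonUnitalStarSubalgebraClass.subtype Λ.toeplitzSubalgebra) := by
    refine NonUnitalStarAlgebra.adjoin_le ?_
    rintro _ ⟨a, b, μ, rfl⟩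
    exact ⟨TC.t μ, h μ, rfl⟩
  exact closure_mono (fun y hy => hle hy) hx

lemma TCKFamily.vertex_mul {A : Type*} [NonUnitalCStarAlgebra A] (T : Λ.TCKFamily A)
    {a b : Λ.Obj} (μ : a ⟶ b) : T.t (𝟙 b) * T.t μ = T.t μ := by
  rw [T.mul, Category.comp_id]

lemma TCKFamily.mul_vertex {A : Type*} [NonUnitalCStarAlgebra A] (T : Λ.TCKFamily A)
    {a b : Λ.Obj} (μ : a ⟶ b) : T.t μ * T.t (𝟙 a) = T.t μ := by
  rw [T.mul, Category.id_comp]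

variable (Λ) in
/-- The sum of the vertex projections, which is the unit of `TC*(Λ)`. -/
noncomputable def TC.unit [Fintype Λ.Obj] : Λ.TC := ∑ v, TC.vertex v

lemma TC.star_unit [Fintype Λ.Obj] : star (TC.unit Λ) = TC.unit Λ := by
  rw [TC.unit, star_sum]
  exact Finset.sum_congr rfl fun v _ => TC.family.star_vertex v

lemma TC.unit_mul_vertex [Fintype Λ.Obj] (v : Λ.Obj) :
    TC.unit Λ * TC.vertex v = TC.vertex v := by
  rw [TC.unit, Finset.sum_mul, Finset.sum_eq_single v]
  · exact TC.family.vertex_mul_self v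
  · intro w _ hw
    exact TC.family.vertex_mul_vertex w v hw
  · simp

lemma TC.vertex_mul_unit [Fintype Λ.Obj] (v : Λ.Obj) :
    TC.vertex v * TC.unit Λ = TC.vertex v := by
  have h : star (TC.vertex v) = TC.vertex v := TC.family.star_vertex v
  rw [← h, ← TC.star_unit, ← star_mul, TC.unit_mul_vertex]

/-- The elements fixed on both sides form a closed star-subalgebra containing the generators. The
two identities are proved together because the star exchanges them. -/
lemma TC.unit_mul_and_mul_unit [Fintype Λ.Obj] (a : Λ.TC) :
    TC.unit Λ * a = a ∧ a * TC.unit Λ = a := by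
  let S : NonUnitalStarSubalgebra ℂ Λ.TC :=
    { carrier := {a | TC.unit Λ * a = a ∧ a * TC.unit Λ = a}
      add_mem' := by
        rintro a b ⟨h1, h2⟩ ⟨h3, h4⟩
        exact ⟨by rw [mul_add, h1, h3], by rw [add_mul, h2, h4]⟩
      zero_mem' := ⟨mul_zero _, zero_mul _⟩
      mul_mem' := by
        rintro a b ⟨h1, h2⟩ ⟨h3, h4⟩
        exact ⟨by rw [← mul_assoc, h1], by rw [mul_assoc, h4]⟩
      smul_mem' := by
        rintro c a ⟨h1, h2⟩
        exact ⟨by rw [mul_smul_comm, h1], by rw [smul_mul_assoc, h2]⟩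
      star_mem' := by
        rintro a ⟨h1, h2⟩
        constructor
        · rw [← TC.star_unit, ← star_mul, h2]
        · rw [← TC.star_unit, ← star_mul, h1] }
  have hS : Dense (S : Set Λ.TC) := TC.dense_of_t_mem S fun {a b} μ => by
    have h1 : TC.vertex b * TC.t μ = TC.t μ := TC.family.vertex_mul μ
    have h2 : TC.t μ * TC.vertex a = TC.t μ := TC.family.mul_vertex μ
    constructor
    · rw [← h1, ← mul_assoc, TC.unit_mul_vertex]
    · rw [← h2, mul_assoc, TC.vertex_mul_unit]
  have hc : IsClosed (S : Set Λ.TC) :=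
    (isClosed_eq (by fun_prop) continuous_id).inter (isClosed_eq (by fun_prop) continuous_id)
  have := hS.closure_eq
  rw [hc.closure_eq] at this
  exact this.ge (Set.mem_univ a)

/-! ### Analyticity of the generators -/

lemma isAnalyticExtension_t (r : Fin k → ℝ) {a b : Λ.Obj} (μ : a ⟶ b) :
    IsAnalyticExtension (Λ.dynamics r) (TC.t μ)
      (fun z => Complex.exp (Complex.I * (z * (∑ j, r j * (Λ.deg μ j : ℝ) : ℝ))) • TC.t μ) :=
  isAnalyticExtension_of_eigen _ fun s => dynamicsHom_t r s μ

lemma isAnalyticExtension_star_t (r : Fin k → ℝ) {a b : Λ.Obj} (μ : a ⟶ b) :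
    IsAnalyticExtension (Λ.dynamics r) (star (TC.t μ))
      (fun z => Complex.exp (Complex.I * (z * (-∑ j, r j * (Λ.deg μ j : ℝ) : ℝ))) •
        star (TC.t μ)) :=
  isAnalyticExtension_of_eigen _ fun s => by
    have h : Λ.dynamics r s (TC.t μ) = phase r s μ • TC.t μ := dynamicsHom_t r s μ
    rw [map_star, h, star_smul, phase, Complex.star_def, ← Complex.exp_conj, map_mul,
      Complex.conj_I, Complex.conj_ofReal]
    congr 2
    push_cast
    ring

lemma dense_analyticSubalgebra (r : Fin k → ℝ) :
    Dense (analyticSubalgebra (Λ.dynamics r) : Set Λ.TC) :=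
  TC.dense_of_t_mem _ fun μ =>
    ⟨⟨_, isAnalyticExtension_t r μ⟩, ⟨_, isAnalyticExtension_star_t r μ⟩⟩

/-! ### KMS states -/

section KMS

variable {r : Fin k → ℝ} {β : ℝ} {φ : Λ.TC →L[ℂ] ℂ}

/-- Moving `t_μ` to the right of `t_μ^*` replaces it by `α_{iβ}(t_μ) = e^{-β r·d(μ)} t_μ`, and then
`t_μ^* t_μ = t_{s(μ)}`. -/
lemma kms_range_projection (hφ : IsKMSState (Λ.dynamics r) β φ) {a b : Λ.Obj} (μ : a ⟶ b) :
    φ (TC.t μ * star (TC.t μ)) =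
      (Real.exp (-β * ∑ j, r j * (Λ.deg μ j : ℝ)) : ℝ) * φ (TC.vertex a) := by
  rw [hφ.2 _ _ _ _ (isAnalyticExtension_t r μ) (isAnalyticExtension_star_t r μ), mul_smul_comm,
    map_smul, smul_eq_mul]
  have h : star (TC.t μ) * TC.t μ = TC.vertex a := TC.family.star_mul_self μ
  rw [h]
  congr 1
  rw [Complex.ofReal_exp]
  congr 1
  push_cast
  linear_combination (β * ∑ j, (r j : ℂ) * (Λ.deg μ j : ℂ)) * Complex.I_mul_I

/-- When the degrees agree, a minimal common extension adds only paths of degree `0`. So `μα = νβ`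
is factored twice with degrees `(d(μ), 0)`, and uniqueness gives `μ = ν`. This is what makes the
range projections of paths of equal degree orthogonal. -/
lemma eq_of_minExt_nonempty {a b : Λ.Obj} {μ ν : a ⟶ b} (hd : Λ.deg μ = Λ.deg ν)
    (h : (Λ.minExt μ ν).Nonempty) : μ = ν := by
  obtain ⟨⟨c, x, y⟩, h1, h2⟩ := h
  dsimp only at h1 h2
  have h3 := h2
  rw [h1, hd, sup_idem, Λ.deg_comp] at h3
  rw [← hd, sup_idem, Λ.deg_comp] at h2
  have hx : Λ.deg x = 0 := by simpa using h2
  have hy : Λ.deg y = 0 := by simpa using h3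
  obtain ⟨q, -, hq⟩ := Λ.factor (x ≫ μ) (Λ.deg μ) 0 (by rw [Λ.deg_comp, hx])
  have e1 := hq ⟨a, x, μ⟩ ⟨rfl, hx, rfl⟩
  have e2 := hq ⟨a, y, ν⟩ ⟨hd.symm, hy, h1.symm⟩
  have e3 := e1.trans e2.symm
  simp only [Sigma.mk.injEq, heq_eq_eq, Prod.mk.injEq, true_and] at e3
  exact e3.2

lemma TC.star_t_mul_t_of_ne {a b : Λ.Obj} {μ ν : a ⟶ b} (hd : Λ.deg μ = Λ.deg ν) (h : μ ≠ ν) :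
    star (TC.t μ) * TC.t ν = 0 := by
  have h1 : Λ.minExt μ ν = ∅ :=
    Set.not_nonempty_iff_eq_empty.1 fun hne => h (eq_of_minExt_nonempty hd hne)
  refine (TC.family.star_mul μ ν).trans ?_
  rw [h1, finsum_mem_empty]

lemma finite_loops (v : Λ.Obj) (n : Fin k → ℕ) : Finite {f : v ⟶ v // Λ.deg f = n} := by
  have := Λ.finite_paths n
  refine Finite.of_injective (β := {p : Σ a b : Λ.Obj, (a ⟶ b) // Λ.deg p.2.2 = n})
    (fun p => ⟨⟨_, _, p.1⟩, p.2⟩) ?_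
  rintro ⟨f, hf⟩ ⟨g, hg⟩ hfg
  simpa using hfg

open scoped ComplexOrder in
/-- A KMS state vanishes at a vertex with too many loops. -/
lemma kms_vertex_eq_zero (hφ : IsKMSState (Λ.dynamics r) β φ) (v : Λ.Obj) (n : Fin k → ℕ)
    (hn : 1 < (Nat.card {f : v ⟶ v // Λ.deg f = n} : ℝ) *
      Real.exp (-β * ∑ j, r j * (n j : ℝ))) : φ (TC.vertex v) = 0 := by
  have := finite_loops v n
  have := Fintype.ofFinite {f : v ⟶ v // Λ.deg f = n}
  -- The range projections of the loops: mutually orthogonal and below `t_v`, so `t_v - ∑ p f` is a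
  -- projection.
  let p : {f : v ⟶ v // Λ.deg f = n} → Λ.TC := fun f => TC.t f.1 * star (TC.t f.1)
  have hpt : ∀ f, star (p f) = p f := fun f => by simp only [p, star_mul, star_star]
  have hss : ∀ f : {f : v ⟶ v // Λ.deg f = n}, star (TC.t f.1) * TC.t f.1 = TC.vertex v :=
    fun f => TC.family.star_mul_self f.1
  have hvt : ∀ f : v ⟶ v, TC.vertex v * TC.t f = TC.t f := fun f => TC.family.vertex_mul f
  have htv : ∀ f : v ⟶ v, TC.t f * TC.vertex v = TC.t f := fun f => TC.family.mul_vertex f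
  have hvv : TC.vertex v * TC.vertex v = TC.vertex v := TC.family.vertex_mul_self v
  have hsv : star (TC.vertex v) = TC.vertex v := TC.family.star_vertex v
  have hpp : ∀ f, p f * p f = p f := fun f => by
    simp only [p]
    rw [mul_assoc, ← mul_assoc (star _), hss, ← mul_assoc, htv]
  have hpq : ∀ f g, f ≠ g → p f * p g = 0 := fun f g hfg => by
    simp only [p]
    rw [mul_assoc, ← mul_assoc (star _), TC.star_t_mul_t_of_ne (f.2.trans g.2.symm)
      (fun h => hfg (Subtype.ext h)), zero_mul, mul_zero]
  have hvp : ∀ f, TC.vertex v * p f = p f := fun f => by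
    simp only [p]
    rw [← mul_assoc, hvt]
  have hQs : star (∑ f, p f) = ∑ f, p f := by
    rw [star_sum]; exact Finset.sum_congr rfl fun f _ => hpt f
  have hvQ : TC.vertex v * ∑ f, p f = ∑ f, p f := by
    rw [Finset.mul_sum]; exact Finset.sum_congr rfl fun f _ => hvp f
  have hQv : (∑ f, p f) * TC.vertex v = ∑ f, p f := by
    rw [← hQs, ← hsv, ← star_mul, hvQ]
  have hQQ : (∑ f, p f) * ∑ f, p f = ∑ f, p f := by
    rw [Finset.sum_mul]
    refine Finset.sum_congr rfl fun f _ => ?_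
    rw [Finset.mul_sum, Finset.sum_eq_single f (fun g _ hg => hpq f g hg.symm) (by simp), hpp]
  -- Positivity is available for elements `a^* a`; a projection is of this form with `a` the
  -- projection itself.
  have hpos := hφ.1.1 (TC.vertex v - ∑ f, p f)
  have hsq : star (TC.vertex v - ∑ f, p f) * (TC.vertex v - ∑ f, p f) =
      TC.vertex v - ∑ f, p f := by
    rw [star_sub, hsv, hQs, sub_mul, mul_sub, mul_sub, hvv, hvQ, hQv, hQQ, sub_self, sub_zero]
  have hφp : ∀ f, φ (p f) = (Real.exp (-β * ∑ j, r j * (n j : ℝ)) : ℝ) * φ (TC.vertex v) :=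
    fun f => by rw [← f.2]; exact kms_range_projection hφ f.1
  have hv := hφ.1.1 (TC.vertex v)
  rw [hsv, hvv] at hv
  rw [hsq, map_sub, map_sum, Finset.sum_congr rfl fun f _ => hφp f, Finset.sum_const,
    Finset.card_univ, ← Nat.card_eq_fintype_card, nsmul_eq_mul, ← mul_assoc] at hpos
  rw [Complex.nonneg_iff] at hv hpos
  set N : ℝ := (Nat.card {f : v ⟶ v // Λ.deg f = n} : ℝ) *
    Real.exp (-β * ∑ j, r j * (n j : ℝ)) with hN
  have hre : (φ (TC.vertex v) - (N : ℂ) * φ (TC.vertex v)).re =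
      (φ (TC.vertex v)).re - N * (φ (TC.vertex v)).re := by
    rw [Complex.sub_re, Complex.re_ofReal_mul]
  have hpos1 := hpos.1
  have hNc : ((Nat.card {f : v ⟶ v // Λ.deg f = n} : ℕ) : ℂ) *
      ((Real.exp (-β * ∑ j, r j * (n j : ℝ)) : ℝ) : ℂ) = (N : ℂ) := by
    rw [hN]; push_cast; rfl
  rw [hNc, hre] at hpos1
  -- With `y` the real part of `φ(t_v)`: `y ≥ 0`, `(1 - N) y ≥ 0` and `N > 1` force `y = 0`.
  exact Complex.ext (by simp only [Complex.zero_re]; nlinarith [hv.1]) hv.2.symm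

end KMS

end FinKGraph


namespace FinKGraph

variable {k : ℕ} {Λ : FinKGraph k}

/-! ### Families vanishing on a hereditary set -/

/-- The image of a family under a homomorphism. -/
noncomputable def TCKFamily.map {A B : Type*} [NonUnitalCStarAlgebra A] [NonUnitalCStarAlgebra B]
    (T : Λ.TCKFamily A) (f : A →⋆ₙₐ[ℂ] B) : Λ.TCKFamily B where
  t μ := f (T.t μ)
  star_vertex v := by rw [← map_star, T.star_vertex]
  vertex_mul_self v := by rw [← map_mul, T.vertex_mul_self]
  vertex_mul_vertex v w h := by rw [← map_mul, T.vertex_mul_vertex v w h, map_zero]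
  mul ν μ := by rw [← map_mul, T.mul]
  star_mul_self μ := by rw [← map_star, ← map_mul, T.star_mul_self]
  star_mul μ ν := by
    rw [← map_star, ← map_mul, T.star_mul]
    refine ((f : A →+ B).map_finsum_mem _ (TC.minExt_finite μ ν)).trans ?_
    refine finsum_mem_congr rfl fun p _ => ?_
    change f _ = _
    rw [map_mul, map_star]

section Restrict

variable {H : Set Λ.Obj} (hH : Λ.IsHereditary H) {A : Type*} [NonUnitalCStarAlgebra A]

lemma TCKFamily.t_eq_zero (S : Λ.TCKFamily A) {a b : Λ.Obj} (μ : a ⟶ b) (h : S.t (𝟙 a) = 0) :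
    S.t μ = 0 := by
  rw [← CStarRing.star_mul_self_eq_zero_iff, S.star_mul_self, h]

/-- The restriction to `Λ \ H` of a family that vanishes on `H`. -/
noncomputable def TCKFamily.restrict (S : Λ.TCKFamily A) (hS : ∀ v ∈ H, S.t (𝟙 v) = 0) :
    (Λ.remove H hH).TCKFamily A where
  t {a b} μ := S.t (a := a.1) (b := b.1) μ
  star_vertex v := S.star_vertex v.1
  vertex_mul_self v := S.vertex_mul_self v.1
  vertex_mul_vertex v w h := S.vertex_mul_vertex v.1 w.1 fun e => h (Subtype.ext e)
  mul {a b c} ν μ := S.mul (a := a.1) (b := b.1) (c := c.1) ν μ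
  star_mul_self {a b} μ := S.star_mul_self (a := a.1) (b := b.1) μ
  star_mul {a b c} μ ν := by
    refine (S.star_mul (a := a.1) (b := b.1) (c := c.1) μ ν).trans ?_
    let g : (Σ e : (Λ.remove H hH).Obj, (e ⟶ a) × (e ⟶ b)) →
        Σ e : Λ.Obj, (e ⟶ a.1) × (e ⟶ b.1) := fun p => ⟨p.1.1, p.2.1, p.2.2⟩
    have hg : Function.Injective g := by
      rintro ⟨⟨e, he⟩, α, β⟩ ⟨⟨e', he'⟩, α', β'⟩ h
      cases h
      rfl
    refine Eq.trans ?_ (finsum_mem_image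
      (f := fun p : Σ e : Λ.Obj, (e ⟶ a.1) × (e ⟶ b.1) => S.t p.2.1 * star (S.t p.2.2))
      (s := (Λ.remove H hH).minExt μ ν) hg.injOn)
    -- The two index sets differ only by extensions whose source lies in `H`, and the corresponding
    -- terms are zero.
    refine finsum_mem_inter_support_eq' _ _ _ ?_
    rintro ⟨e, α, β⟩ hp
    have he : e ∉ H := fun he => hp (by
      dsimp only
      rw [S.t_eq_zero α (hS e he), zero_mul])
    constructor
    · intro h
      exact ⟨⟨⟨e, he⟩, α, β⟩, h, rfl⟩
    · rintro ⟨q, hq, hqp⟩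
      rw [← hqp]
      exact hq

lemma TCKFamily.extend_restrict (S : Λ.TCKFamily A) (hS : ∀ v ∈ H, S.t (𝟙 v) = 0) :
    (S.restrict hH hS).extend hH = S := by
  ext a b μ
  change extendFun hH (S.restrict hH hS) μ = S.t μ
  by_cases ha : a ∈ H
  · rw [extendFun_of_mem hH _ μ ha, S.t_eq_zero μ (hS a ha)]
  · rw [extendFun_of_notMem hH _ μ ha fun hb => ha (hH hb ⟨μ⟩)]
    rfl

end Restrict

/-- Both sides evaluate `a` at the same coordinate of the product, the one indexed by `T.extend hH`.
-/
lemma lift_quotientMap {H : Set Λ.Obj} (hH : Λ.IsHereditary H) {A : Type}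
    [NonUnitalCStarAlgebra A] (T : (Λ.remove H hH).TCKFamily A) (a : Λ.TC) :
    TC.lift T (quotientMap hH a) = TC.lift (T.extend hH) a := rfl

/-! ### KMS states vanishing on a hereditary set -/

lemma TC.norm_unit_le_one [Fintype Λ.Obj] : ‖TC.unit Λ‖ ≤ 1 := by
  have h : ‖TC.unit Λ‖ * ‖TC.unit Λ‖ = ‖TC.unit Λ‖ := by
    rw [← CStarRing.norm_star_mul_self, TC.star_unit, (TC.unit_mul_and_mul_unit _).1]
  have h0 := norm_nonneg (TC.unit Λ)
  by_contra hc
  push Not at hc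
  nlinarith

section KMS

variable {r : Fin k → ℝ} {β : ℝ} {φ : Λ.TC →L[ℂ] ℂ}

open scoped ComplexOrder InnerProductSpace

/-- If a KMS state vanishes at a vertex `v`, then `t_v` acts as zero in its GNS representation. -/
lemma gns_vertex_eq_zero (hφ : IsKMSState (Λ.dynamics r) β φ) {E : Type*}
    [NormedAddCommGroup E] [InnerProductSpace ℂ E] (π : Λ.TC → E →L[ℂ] E) (V : Λ.TC → E)
    (hV : DenseRange V) (hin : ∀ a b, ⟪V a, V b⟫_ℂ = φ (star a * b))
    (hπ : ∀ a b, π a (V b) = V (a * b)) {v : Λ.Obj} (hv : φ (TC.vertex v) = 0) :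
    π (TC.vertex v) = 0 := by
  have hvv : TC.vertex v * TC.vertex v = TC.vertex v := TC.family.vertex_mul_self v
  have hsv : star (TC.vertex v) = TC.vertex v := TC.family.star_vertex v
  -- The vector of `t_v` has squared norm `φ(t_v) = 0`, so pairing it with `V c` shows that `φ(t_v
  -- c) = 0`.
  have hVv : V (TC.vertex v) = 0 := by
    rw [← inner_self_eq_zero (𝕜 := ℂ), hin, hsv, hvv, hv]
  have hφv : ∀ c, φ (TC.vertex v * c) = 0 := fun c => by
    have := hin (TC.vertex v) c
    rwa [hVv, inner_zero_left, hsv, eq_comm] at this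
  have hv_an : TC.vertex v ∈ analyticSubalgebra (Λ.dynamics r) :=
    ⟨⟨_, isAnalyticExtension_t r _⟩, ⟨_, isAnalyticExtension_star_t r _⟩⟩
  -- For `b` and `b^*` analytic, the KMS condition turns this into `φ(t_v b F(iβ))`, where `F`
  -- extends the orbit of `b^*`; this is zero by `hφv`. Density and continuity give all `b`.
  have hsub : ∀ b, φ (star b * (TC.vertex v * b)) = 0 := by
    have hc : IsClosed {b | φ (star b * (TC.vertex v * b)) = 0} :=
      isClosed_eq (by fun_prop) continuous_const
    have hd : Dense {b | φ (star b * (TC.vertex v * b)) = 0} :=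
      (dense_analyticSubalgebra r).mono fun b hb => by
        obtain ⟨F, hF⟩ := hb.2
        obtain ⟨G, hG⟩ := (mul_mem hv_an hb).1
        change φ _ = 0
        rw [hφ.2 _ _ F G hF hG, mul_assoc, hφv]
    intro b
    have := hd.closure_eq
    rw [hc.closure_eq] at this
    exact this.ge (Set.mem_univ b)
  refine ContinuousLinearMap.ext fun y => ?_
  refine hV.induction_on (p := fun y => π (TC.vertex v) y = (0 : E →L[ℂ] E) y) y
    (isClosed_eq (by fun_prop) (by fun_prop)) fun b => ?_
  -- The squared norm of `π(t_v) V(b)` is `φ(b^* t_v b)`.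
  rw [hπ, zero_apply, ← inner_self_eq_zero (𝕜 := ℂ), hin, star_mul, hsv,
    mul_assoc, ← mul_assoc (TC.vertex v), hvv, hsub]

/-- A KMS state that vanishes at the vertices of a hereditary set `H` factors through `q_H`. -/
theorem kms_factors_quotientMap [Finite Λ.Obj] (hφ : IsKMSState (Λ.dynamics r) β φ)
    {H : Set Λ.Obj} (hH : Λ.IsHereditary H) (hv : ∀ v ∈ H, φ (TC.vertex v) = 0) :
    ∃ ψ : (Λ.remove H hH).TC →L[ℂ] ℂ, IsCStarState ψ ∧
      ∀ a : Λ.TC, φ a = ψ (quotientMap hH a) := by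
  have := Fintype.ofFinite Λ.Obj
  obtain ⟨s, π, V, hV, hin, hπ⟩ := exists_gns φ hφ.1.1
  have hS : ∀ v ∈ H, (TC.family.map π).t (𝟙 v) = 0 := fun v hvH =>
    gns_vertex_eq_zero hφ π V hV hin hπ (hv v hvH)
  -- The lift exists because the operators on `ℓ²(s)` form a C*-algebra in `Type`.
  let ρ := TC.lift ((TC.family.map π).restrict hH hS)
  have hρ : ∀ a, ρ (quotientMap hH a) = π a := fun a => by
    have h : TC.lift (TC.family.map π) = π := TC.hom_ext _ _ fun μ => rfl
    rw [lift_quotientMap, TCKFamily.extend_restrict, h]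
  have hΩ : ‖V (TC.unit Λ)‖ ^ 2 ≤ 1 := by
    calc ‖V (TC.unit Λ)‖ ^ 2 = ‖⟪V (TC.unit Λ), V (TC.unit Λ)⟫_ℂ‖ := by
          rw [inner_self_eq_norm_sq_to_K]; simp
      _ = ‖φ (TC.unit Λ)‖ := by rw [hin, TC.star_unit, (TC.unit_mul_and_mul_unit _).1]
      _ ≤ ‖φ‖ * ‖TC.unit Λ‖ := φ.le_opNorm _
      _ ≤ 1 := by rw [hφ.1.2, one_mul]; exact TC.norm_unit_le_one
  -- The vector functional of `ρ` at the image `V(1)` of the unit; composed with `q_H` it is `⟨V(1),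
  -- π(a) V(1)⟩ = φ(a)`.
  let ψ₀ : (Λ.remove H hH).TC →ₗ[ℂ] ℂ :=
    { toFun := fun b => ⟪V (TC.unit Λ), ρ b (V (TC.unit Λ))⟫_ℂ
      map_add' := fun b c => by rw [map_add, add_apply, inner_add_right]
      map_smul' := fun c b => by
        rw [map_smul, smul_apply, inner_smul_right]; rfl }
  have hψ₀ : ∀ b, ‖ψ₀ b‖ ≤ 1 * ‖b‖ := fun b => by
    have h1 : ‖ρ b‖ ≤ ‖b‖ := NonUnitalStarAlgHom.norm_apply_le ρ b
    calc ‖ψ₀ b‖ = ‖⟪V (TC.unit Λ), ρ b (V (TC.unit Λ))⟫_ℂ‖ := rfl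
      _ ≤ ‖V (TC.unit Λ)‖ * ‖ρ b (V (TC.unit Λ))‖ := norm_inner_le_norm (𝕜 := ℂ) _ _
      _ ≤ ‖V (TC.unit Λ)‖ * (‖ρ b‖ * ‖V (TC.unit Λ)‖) := by
          gcongr; exact (ρ b).le_opNorm _
      _ = ‖V (TC.unit Λ)‖ ^ 2 * ‖ρ b‖ := by ring
      _ ≤ 1 * ‖b‖ := by gcongr
  have hfac : ∀ a, φ a = ψ₀.mkContinuous 1 hψ₀ (quotientMap hH a) := fun a => by
    change φ a = ⟪V (TC.unit Λ), ρ (quotientMap hH a) (V (TC.unit Λ))⟫_ℂ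
    rw [hρ, hπ, hin, TC.star_unit, (TC.unit_mul_and_mul_unit a).2, (TC.unit_mul_and_mul_unit a).1]
  refine ⟨ψ₀.mkContinuous 1 hψ₀, ⟨fun b => ?_, le_antisymm ?_ ?_⟩, hfac⟩
  · change 0 ≤ ⟪V (TC.unit Λ), ρ (star b * b) (V (TC.unit Λ))⟫_ℂ
    rw [map_mul, map_star, mul_apply_eq_comp, ContinuousLinearMap.star_eq_adjoint,
      ContinuousLinearMap.adjoint_inner_right, inner_self_eq_norm_sq_to_K]
    exact pow_nonneg (RCLike.ofReal_nonneg.2 (norm_nonneg _)) 2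
  · exact ψ₀.mkContinuous_norm_le zero_le_one hψ₀
  -- The lower bound on the norm: `φ = ψ ∘ q_H` with `q_H` contractive, so `1 = ‖φ‖ ≤ ‖ψ‖`.
  · refine hφ.1.2.symm.trans_le ?_
    refine φ.opNorm_le_bound (norm_nonneg _) fun a => ?_
    rw [hfac]
    refine ((ψ₀.mkContinuous 1 hψ₀).le_opNorm _).trans ?_
    gcongr
    exact NonUnitalStarAlgHom.norm_apply_le (quotientMap hH) a

end KMS

end FinKGraph

/-! ### The four-vertex graph below the critical temperature `β = 1` -/

theorem mainTheorem8 (Λ : FinKGraph 2) (e : FourVertex ≃ Λ.Obj)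
    (hΛ : Λ.HasFourVertexSkeleton e) (r : Fin 2 → ℝ)
    (hr₁ : r 0 = Real.log 8) (hr₂ : Real.log 12 < r 1) (β : ℝ) (hβ : β < 1)
    (φ : Λ.TC →L[ℂ] ℂ) (hφ : IsKMSState (Λ.dynamics r) β φ) :
    φ (FinKGraph.TC.vertex (e .x)) = 0 ∧
      ∃ ψ : (Λ.remove {e .x} hΛ.isHereditary).TC →L[ℂ] ℂ, IsCStarState ψ ∧
        ∀ a : Λ.TC, φ a = ψ (FinKGraph.quotientMap hΛ.isHereditary a) := by
  have hx : φ (FinKGraph.TC.vertex (e .x)) = 0 := by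
    -- Degree `e₁` is the right choice: its eight loops work for every `β < 1`, whereas the twelve
    -- loops of degree `e₂` would only cover `β < ln 12 / r₂`, which is smaller than `1`.
    refine FinKGraph.kms_vertex_eq_zero hφ (e .x) (Pi.single 0 1) ?_
    have h8 : (8 : ℝ) = Real.exp (Real.log 8) := (Real.exp_log (by norm_num)).symm
    have hlog : 0 < Real.log 8 := Real.log_pos (by norm_num)
    have hcard : fourVertexMatrix 0 .x .x = 8 := rfl
    rw [hΛ 0 .x .x, hcard, Fin.sum_univ_two, hr₁]
    simp only [Pi.single_eq_same, Nat.cast_one, mul_one, Nat.cast_ofNat]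
    rw [Pi.single_eq_of_ne (by decide), Nat.cast_zero, mul_zero, add_zero]
    -- Writing the number of loops as `e^{ln 8}` reduces the claim to `(1 - β) ln 8 > 0`.
    nth_rw 1 [h8]
    rw [← Real.exp_add, Real.one_lt_exp_iff]
    nlinarith
  have : Finite FourVertex := Finite.of_surjective
    (fun i : Fin 4 => ![FourVertex.u, .v, .w, .x] i) fun y => by
      cases y
      exacts [⟨0, rfl⟩, ⟨1, rfl⟩, ⟨2, rfl⟩, ⟨3, rfl⟩]
  have : Finite Λ.Obj := Finite.of_equiv _ e
  exact ⟨hx, FinKGraph.kms_factors_quotientMap hφ hΛ.isHereditary fun v hv => by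
    rw [Set.mem_singleton_iff.1 hv, hx]⟩
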